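/- Let $n\ge 1$ and $b\ge 1$ be integers, and let $q_i=[x_i:y_i]$ $(0\le i\le n)$ be $n+1$ distinct points of $\mathbb P^1=\mathbb P^1(\mathbb C)$. For points $p_i=[u_i:v_i]\in\mathbb P^1$ $(1\le i\le n)$ put $$\sigma_j(p_1,\dots,p_n)=\sum_{A\subset\{1,\dots,n\},\,|A|=j}\ \prod_{\alpha\in A}u_\alpha\prod_{\beta\notin A}v_\beta\qquad(0\le j\le n),$$ and let $\varphi:(\mathbb P^1)^n\to\mathbb P^n$ be the map $\varphi(p_1,\dots,p_n)=[\sigma_0:\dots:\sigma_n]$. Let $T$ be the projective transformation of $\mathbb P^n$ given by the invertible matrix with entries $(-1)^{n-j}y_i^{\,j}x_i^{\,n-j}$ $(0\le i,j\le n)$; it carries the hyperplane $\varphi(\{p_1=q_i\})$ to the coordinate hyperplane $Y_i=0$. For $1\le k\le n$ let $$D_{n,k}=T\bigl(\varphi(\{(p_1,\dots,p_n)\in(\mathbb P^1)^n:\ p_k=p_{k+1}=\dots=p_n\})\bigr)\subset\mathbb P^n ,$$ so that $D_{n,1}$ is the rational normal curve parametrized by $[u:v]\mapsto[(uy_0-vx_0)^n:\dots:(uy_n-vx_n)^n]$.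 Finally let $\psi_b:\mathbb P^n\to\mathbb P^n$, $[Z_0:\dots:Z_n]\mapsto[Z_0^b:\dots:Z_n^b]$, and $D_{n,k}^{(b)}=\psi_b^{-1}(D_{n,k})$. Then: (1) the curve $D_{n,1}^{(b)}$ is irreducible (in the Zariski topology of $\mathbb P^n$) if and only if $\gcd(n,b)=1$; (2) if $\gcd(n,b)=1$, then $D_{n,k}^{(b)}$ is irreducible for every $k$ with $1\le k\le n$. -/

import Mathlib

namespace LiftedDiscriminant

/-- The complex projective space `ℙⁿ`, with homogeneous coordinates indexed by `0, …, n`. -/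
abbrev PP (n : ℕ) : Type := Projectivization ℂ (Fin (n + 1) → ℂ)

/-- A vector of `ℂ²` standing for homogeneous coordinates `[u : v]` on `ℙ¹`
is written `w` with `w 0 = u` and `w 1 = v`.
This is the homogeneous elementary symmetric polynomial `σ_j`: the sum over the
`j`-element subsets `A` of `∏_{α ∈ A} u_α * ∏_{β ∉ A} v_β`. -/
noncomputable def sigma {n : ℕ} (j : ℕ) (w : Fin n → Fin 2 → ℂ) : ℂ :=
  ∑ A ∈ (Finset.univ : Finset (Fin n)).powersetCard j,
    (∏ α ∈ A, w α 0) * ∏ β ∈ Aᶜ, w β 1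

theorem sigma_ne_zero {n : ℕ} (w : Fin n → Fin 2 → ℂ) (hw : ∀ i, w i ≠ 0) :
    (fun j : Fin (n + 1) => sigma (j : ℕ) w) ≠ 0 := by
  intro h
  have hs : ∀ j < n + 1, sigma j w = 0 := fun j hj => congrFun h ⟨j, hj⟩
  have key : (∏ i : Fin n, (Polynomial.C (w i 0) * Polynomial.X + Polynomial.C (w i 1))) = 0 := by
    rw [Finset.prod_add, Finset.sum_powerset]
    simp only [Finset.card_univ, Fintype.card_fin]
    refine Finset.sum_eq_zero fun j hj => ?_
    have h1 : ∀ A ∈ (Finset.univ : Finset (Fin n)).powersetCard j,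
        ((∏ i ∈ A, (Polynomial.C (w i 0) * Polynomial.X)) *
          ∏ i ∈ Finset.univ \ A, Polynomial.C (w i 1)) =
        Polynomial.C ((∏ α ∈ A, w α 0) * ∏ β ∈ Aᶜ, w β 1) * Polynomial.X ^ j := by
      intro A hA
      rw [Finset.mem_powersetCard] at hA
      rw [Finset.prod_mul_distrib, Finset.prod_const, hA.2, ← Finset.compl_eq_univ_sdiff]
      simp only [map_mul, map_prod]
      ring
    rw [Finset.sum_congr rfl h1, ← Finset.sum_mul, ← map_sum]
    have := hs j (Finset.mem_range.mp hj)
    rw [sigma] at this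
    rw [this]
    simp
  rw [Finset.prod_eq_zero_iff] at key
  obtain ⟨i, -, hi⟩ := key
  apply hw i
  have e0 := congrArg (fun P => Polynomial.coeff P 1) hi
  have e1 := congrArg (fun P => Polynomial.coeff P 0) hi
  simp [Polynomial.coeff_C] at e0 e1
  ext a
  fin_cases a
  · exact e0
  · exact e1

/-- The quotient map `φ : (ℙ¹)ⁿ → ℙⁿ`, `(p₁, …, pₙ) ↦ [σ₀ : … : σₙ]`. As each `σ_j` is
linear in each `(u_i, v_i)`, the choice of representatives is immaterial; see `phi_mk`. -/
noncomputable def phi {n : ℕ} (p : Fin n → PP 1) : PP n :=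
  Projectivization.mk ℂ (fun j : Fin (n + 1) => sigma (j : ℕ) (fun i => (p i).rep))
    (sigma_ne_zero _ fun i => (p i).rep_nonzero)

theorem sigma_smul {n : ℕ} (j : ℕ) (c : Fin n → ℂ) (w : Fin n → Fin 2 → ℂ) :
    sigma j (fun i => c i • w i) = (∏ i, c i) * sigma j w := by
  unfold sigma
  rw [Finset.mul_sum]
  refine Finset.sum_congr rfl fun A _ => ?_
  simp only [Pi.smul_apply, smul_eq_mul, Finset.prod_mul_distrib]
  rw [← Finset.prod_mul_prod_compl A c]
  ring

theorem phi_mk {n : ℕ} (w : Fin n → Fin 2 → ℂ) (hw : ∀ i, w i ≠ 0) :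
    phi (fun i => Projectivization.mk ℂ (w i) (hw i)) =
      Projectivization.mk ℂ (fun j : Fin (n + 1) => sigma (j : ℕ) w) (sigma_ne_zero w hw) := by
  choose c hc using fun i => Projectivization.exists_smul_eq_mk_rep ℂ (w i) (hw i)
  rw [phi, Projectivization.mk_eq_mk_iff']
  refine ⟨∏ i, (c i : ℂ), ?_⟩
  ext j
  simp only [Pi.smul_apply, smul_eq_mul, ← hc]
  exact (sigma_smul _ (fun i => (c i : ℂ)) w).symm

/-- `Δ_{n,k} = {(p₁, …, pₙ) | p_k = p_{k+1} = … = pₙ}`. The point `p_i` (`1 ≤ i ≤ n`) is the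
value at the index `i - 1` of `Fin n`. -/
def Delta (n k : ℕ) : Set (Fin n → PP 1) :=
  {p | ∀ i j : Fin n, k ≤ (i : ℕ) + 1 → k ≤ (j : ℕ) + 1 → p i = p j}

/-- The projective Vandermonde matrix of `q_i = [x_i : y_i]`, where `x_i = q i 0` and
`y_i = q i 1`; its entries are `(-1)^{n-j} y_i^j x_i^{n-j}`. -/
def van {n : ℕ} (q : Fin (n + 1) → Fin 2 → ℂ) : Matrix (Fin (n + 1)) (Fin (n + 1)) ℂ :=
  Matrix.of fun i j => (-1) ^ (n - (j : ℕ)) * q i 1 ^ (j : ℕ) * q i 0 ^ (n - (j : ℕ))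

theorem van_injective {n : ℕ} (q : Fin (n + 1) → Fin 2 → ℂ) (hq : ∀ i, q i ≠ 0)
    (hinj : Function.Injective fun i => Projectivization.mk ℂ (q i) (hq i)) :
    Function.Injective (van q).mulVecLin := by
  have hv : van q = Matrix.projVandermonde (fun i => q i 1) (fun i => - q i 0) := by
    ext i j
    rw [Matrix.projVandermonde_apply, neg_pow]
    simp only [van, Matrix.of_apply, Fin.val_rev]
    rw [show n + 1 - ((j : ℕ) + 1) = n - j by omega]
    ring
  have hdet : (van q).det ≠ 0 := by
    rw [hv, Matrix.det_projVandermonde]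
    refine Finset.prod_ne_zero_iff.mpr fun i _ => Finset.prod_ne_zero_iff.mpr fun j hj h0 => ?_
    have hij : i < j := Finset.mem_Ioi.mp hj
    have hE : q i 0 * q j 1 = q j 0 * q i 1 := by linear_combination -h0
    refine hij.ne (hinj ?_)
    simp only [Projectivization.mk_eq_mk_iff']
    by_cases hj0 : q j 0 = 0
    · have hj1 : q j 1 ≠ 0 := fun h1 => hq j (by ext a; fin_cases a <;> assumption)
      refine ⟨q i 1 / q j 1, ?_⟩
      have hi0 : q i 0 = 0 := by
        rw [hj0, zero_mul] at hE
        exact (mul_eq_zero.mp hE).resolve_right hj1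
      ext a
      fin_cases a
      · simp [hj0, hi0]
      · simp [hj1]
    · refine ⟨q i 0 / q j 0, ?_⟩
      ext a
      fin_cases a
      · simp [hj0]
      · simp only [Fin.mk_one, Pi.smul_apply, smul_eq_mul]
        field_simp
        linear_combination hE
  rw [Matrix.coe_mulVecLin, Matrix.mulVec_injective_iff_isUnit]
  exact (Matrix.isUnit_iff_isUnit_det _).mpr (isUnit_iff_ne_zero.mpr hdet)

/-- The variety `D_{n,k} ⊆ ℙⁿ` in the coordinates `[Y₀ : … : Yₙ]`: the image of `φ(Δ_{n,k})`
under the projective transformation given by the projective Vandermonde matrix of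
`q₀, …, qₙ`, which carries the hyperplane `H_{q_i} = φ({p | p₁ = q_i})` to `Y_i = 0`. -/
noncomputable def D {n : ℕ} (q : Fin (n + 1) → Fin 2 → ℂ) (hq : ∀ i, q i ≠ 0)
    (hinj : Function.Injective fun i => Projectivization.mk ℂ (q i) (hq i)) (k : ℕ) :
    Set (PP n) :=
  Projectivization.map (van q).mulVecLin (van_injective q hq hinj) '' (phi '' Delta n k)

/-- The map `ψ_b : ℙⁿ → ℙⁿ`, `[Z₀ : … : Zₙ] ↦ [Z₀^b : … : Zₙ^b]`. It is used for `b ≥ 1`. -/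
noncomputable def psi {n : ℕ} (b : ℕ) : PP n → PP n :=
  Projectivization.lift
    (fun z => Projectivization.mk ℂ (fun i => (z : Fin (n + 1) → ℂ) i ^ b) (by
      intro h
      exact z.2 (funext fun i => eq_zero_of_pow_eq_zero (congrFun h i))))
    (by
      intro z z' t h
      rw [Projectivization.mk_eq_mk_iff']
      refine ⟨t ^ b, ?_⟩
      ext i
      simp only [h, Pi.smul_apply, smul_eq_mul, mul_pow])

/-- `D_{n,k}^{(b)} = ψ_b⁻¹(D_{n,k})`. -/
noncomputable def Dlift {n : ℕ} (q : Fin (n + 1) → Fin 2 → ℂ) (hq : ∀ i, q i ≠ 0)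
    (hinj : Function.Injective fun i => Projectivization.mk ℂ (q i) (hq i)) (k : ℕ)
    (b : ℕ) : Set (PP n) :=
  psi b ⁻¹' D q hq hinj k

/-- The common zeros in `ℙⁿ` of a set of polynomials. It is only used for sets of homogeneous
polynomials, for which the choice of representatives is immaterial; see `eval_rep_eq_zero`. -/
def zeroLocus {n : ℕ} (S : Set (MvPolynomial (Fin (n + 1)) ℂ)) : Set (PP n) :=
  {p | ∀ F ∈ S, MvPolynomial.eval p.rep F = 0}

theorem eval_rep_eq_zero {n d : ℕ} {F : MvPolynomial (Fin (n + 1)) ℂ} (hF : F.IsHomogeneous d)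
    (v : Fin (n + 1) → ℂ) (hv : v ≠ 0) :
    MvPolynomial.eval (Projectivization.mk ℂ v hv).rep F = 0 ↔ MvPolynomial.eval v F = 0 := by
  obtain ⟨a, ha⟩ := Projectivization.exists_smul_eq_mk_rep ℂ v hv
  have h : MvPolynomial.eval ((a : ℂ) • v) F = (a : ℂ) ^ d * MvPolynomial.eval v F := by
    simp only [MvPolynomial.eval_eq, Finset.mul_sum]
    refine Finset.sum_congr rfl fun m hm => ?_
    have hd : ∑ i ∈ m.support, m i = d := by
      have := hF (MvPolynomial.mem_support_iff.mp hm)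
      rwa [Pi.one_def, ← Finsupp.degree_eq_weight_one, Finsupp.degree_apply] at this
    simp only [Pi.smul_apply, smul_eq_mul, mul_pow, Finset.prod_mul_distrib]
    rw [Finset.prod_pow_eq_pow_sum, hd]
    ring
  rw [← ha, Units.smul_def, h]
  simp

/-- The Zariski topology on `ℙⁿ`: the closed sets are the common zero loci of sets of
homogeneous polynomials. -/
abbrev zariski (n : ℕ) : TopologicalSpace (PP n) :=
  TopologicalSpace.ofClosed
    {Z | ∃ S : Set (MvPolynomial (Fin (n + 1)) ℂ),
      (∀ F ∈ S, ∃ d, F.IsHomogeneous d) ∧ Z = zeroLocus S}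
    ⟨{1}, by
      rintro F rfl
      exact ⟨0, MvPolynomial.isHomogeneous_one _ _⟩, by
      ext p
      simp [zeroLocus]⟩
    (by
      intro A hA
      refine ⟨{F | (∃ d, F.IsHomogeneous d) ∧ ∃ Z ∈ A, ∀ p ∈ Z, MvPolynomial.eval p.rep F = 0},
        fun F hF => hF.1, ?_⟩
      ext p
      constructor
      · rintro hp F ⟨-, Z, hZ, h⟩
        exact h p (hp Z hZ)
      · intro hp Z hZ
        obtain ⟨S, hS, rfl⟩ := hA hZ
        exact fun F hF => hp F ⟨hS F hF, _, hZ, fun r hr => hr F hF⟩)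
    (by
      rintro _ ⟨S, hS, rfl⟩ _ ⟨T, hT, rfl⟩
      refine ⟨{H | ∃ F ∈ S, ∃ G ∈ T, H = F * G}, ?_, ?_⟩
      · rintro _ ⟨F, hF, G, hG, rfl⟩
        obtain ⟨d, hd⟩ := hS F hF
        obtain ⟨e, he⟩ := hT G hG
        exact ⟨d + e, hd.mul he⟩
      · ext p
        constructor
        · rintro (hp | hp) _ ⟨F, hF, G, hG, rfl⟩
          · simp [hp F hF]
          · simp [hp G hG]
        · intro hp
          by_contra hcon
          simp only [Set.mem_union, not_or, zeroLocus, Set.mem_ofPred_eq, not_forall] at hcon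
          obtain ⟨⟨F, hF, hF0⟩, ⟨G, hG, hG0⟩⟩ := hcon
          have := hp _ ⟨F, hF, G, hG, rfl⟩
          rw [map_mul] at this
          exact (mul_ne_zero hF0 hG0) this)

/-- A subset of `ℙⁿ` is irreducible: nonempty and irreducible for the Zariski topology. -/
def IrreducibleSubvariety {n : ℕ} (V : Set (PP n)) : Prop :=
  @IsIrreducible (PP n) (zariski n) V

end LiftedDiscriminant

/-! ### Kummer theory for radicals of non-associated primes. -/

namespace LiftedDiscriminant

/-! After `T`, the coordinates of `φ(w)` are the products over `j` of the linear forms `linForm (q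
i) (w j)`. On the lift, `z i ^ b` is such a product up to a common scalar, with `k` free points, the
last one repeated.

Sufficiency: adjoin a `b`-th root `c (α, i)` of every form `linForm (q i) (w α)`. The forms are
pairwise non-associated primes, so by Kummer theory relations among generic radicals come from the
polynomial ring and persist under specialization; with the Nullstellensatz, the variety of radicals
is irreducible (`isPrime_vanishing_radicals`). Products of radicals map its nonvanishing part into
the lift. This is onto once some point is repeated a number of times prime to `b`, because
root-of-unity ambiguities can then be absorbed (`exists_radicals_of_mem_Dlift`).

Necessity: if `d = gcd(n, b) > 1`, write `n = d n'`, `b = d b'`. On the curve, up to scaling, `z i ^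
b'` agrees with `linForm (q i) w ^ n'` up to a `d`-th root of unity. As `n' < n`, these powers
satisfy a linear relation, so finitely many hypersurfaces cover the curve. None contains it:
rotating one coordinate by a primitive `b`-th root of unity stays on the curve but breaks the
relation. -/

theorem modEq_of_prod_pow_mul_pow_eq {R ι : Type*} [CommRing R] [IsDomain R]
    [UniqueFactorizationMonoid R] [Fintype ι] {l : ι → R} (hl : ∀ j, Prime (l j))
    (hnd : ∀ i j, i ≠ j → ¬ l i ∣ l j) {b : ℕ} {m m' : ι → ℕ} {y z : R} (hy : y ≠ 0) (hz : z ≠ 0)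
    (h : (∏ j, l j ^ m j) * z ^ b = (∏ j, l j ^ m' j) * y ^ b) (i : ι) :
    m i ≡ m' i [MOD b] := by
  classical
  -- The `l i`-adic valuation: the other primes contribute 0, and a `b`-th power contributes a
  -- multiple of `b`.
  have key : ∀ (m : ι → ℕ) (z : R), z ≠ 0 →
      emultiplicity (l i) ((∏ j, l j ^ m j) * z ^ b) = (m i + b * multiplicity (l i) z : ℕ) := by
    intro m z hz
    have hf : FiniteMultiplicity (l i) z :=
      FiniteMultiplicity.of_not_isUnit (hl i).not_isUnit hz
    rw [emultiplicity_mul (hl i), emultiplicity_pow (hl i), Finset.emultiplicity_prod (hl i),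
      Finset.sum_eq_single i, emultiplicity_pow_self_of_prime (hl i),
      hf.emultiplicity_eq_multiplicity]
    · push_cast
      rfl
    · intro j _ hj
      rw [emultiplicity_pow (hl i), emultiplicity_eq_zero.2 (hnd i j hj.symm), mul_zero]
    · simp
  have h1 := key m z hz
  rw [h, key m' y hy] at h1
  have h2 : m' i + b * multiplicity (l i) y = m i + b * multiplicity (l i) z := by
    exact_mod_cast h1
  have h3 := congrArg (· % b) h2
  simpa [Nat.ModEq] using h3.symm

section Kummer

variable {R K L ι : Type} [CommRing R] [IsDomain R] [UniqueFactorizationMonoid R] [Field K]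
  [Algebra R K] [IsFractionRing R K] [Field L] [Algebra K L] [IsGalois K L] [Algebra R L]
  [IsScalarTower R K L] [Fintype ι]

/-- Equal Kummer characters make the quotient of the two monomials Galois-fixed, hence a fraction `y
/ z` over `R`. Its `b`-th power is an identity in `R`, where valuations can be compared. -/
theorem modEq_of_galois_smul_eq {l : ι → R} (hl : ∀ j, Prime (l j))
    (hnd : ∀ i j, i ≠ j → ¬ l i ∣ l j) {b : ℕ} (hb : 0 < b) {a : ι → L}
    (ha : ∀ j, a j ^ b = algebraMap R L (l j)) {m m' : ι → ℕ}
    (h : ∀ g : Gal(L/K), g (∏ j, a j ^ m j) / ∏ j, a j ^ m j =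
      g (∏ j, a j ^ m' j) / ∏ j, a j ^ m' j) (i : ι) :
    m i ≡ m' i [MOD b] := by
  have hinj : Function.Injective (algebraMap R L) := by
    rw [IsScalarTower.algebraMap_eq R K L]
    exact (algebraMap K L).injective.comp (IsFractionRing.injective R K)
  have ha0 : ∀ j, a j ≠ 0 := by
    intro j hj
    have := ha j
    rw [hj, zero_pow hb.ne'] at this
    exact (hl j).ne_zero (hinj (by rw [← this, map_zero]))
  have hp0 : ∀ m : ι → ℕ, ∏ j, a j ^ m j ≠ 0 := fun m =>
    Finset.prod_ne_zero_iff.2 fun j _ => pow_ne_zero _ (ha0 j)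
  obtain ⟨x, hx⟩ := (InfiniteGalois.mem_range_algebraMap_iff_fixed (k := K)
    ((∏ j, a j ^ m j) / ∏ j, a j ^ m' j)).2 fun g => by
      have hg := h g
      have h0 : g (∏ j, a j ^ m' j) ≠ 0 := (map_ne_zero g).2 (hp0 m')
      rw [div_eq_div_iff (hp0 m) (hp0 m')] at hg
      rw [map_div₀, div_eq_div_iff h0 (hp0 m'), hg]
      ring
  obtain ⟨y, z, hz, rfl⟩ := IsFractionRing.div_surjective (A := R) x
  have hz0 : z ≠ 0 := nonZeroDivisors.ne_zero hz
  have hzL : algebraMap R L z ≠ 0 := fun h0 => hz0 (hinj (by rw [h0, map_zero]))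
  rw [map_div₀, ← IsScalarTower.algebraMap_apply, ← IsScalarTower.algebraMap_apply,
    div_eq_div_iff hzL (hp0 m')] at hx
  have hpow : ∀ m : ι → ℕ, (∏ j, a j ^ m j) ^ b = algebraMap R L (∏ j, l j ^ m j) := by
    intro m
    rw [map_prod, ← Finset.prod_pow]
    refine Finset.prod_congr rfl fun j _ => ?_
    rw [map_pow, ← ha, ← pow_mul, ← pow_mul, mul_comm]
  have hE : (∏ j, l j ^ m j) * z ^ b = (∏ j, l j ^ m' j) * y ^ b := by
    apply hinj
    rw [map_mul, map_mul, map_pow, map_pow, ← hpow, ← hpow, ← mul_pow, ← mul_pow, ← hx, mul_comm]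
  have hy : y ≠ 0 := by
    rintro rfl
    rw [map_zero, zero_mul] at hx
    exact mul_ne_zero (hp0 m) hzL hx.symm
  exact modEq_of_prod_pow_mul_pow_eq hl hnd hy hz0 hE i

/-- A polynomial relation over `ℂ` between the radicals `a j = (l j)^(1/b)` of pairwise
non-associated primes `l j` persists under every specialization. -/
theorem eval₂_eq_zero_of_aeval_radical_eq_zero [Algebra ℂ R] [Algebra ℂ K] [Algebra ℂ L]
    [IsScalarTower ℂ R L] [IsScalarTower ℂ K L] {l : ι → R} (hl : ∀ j, Prime (l j))
    (hnd : ∀ i j, i ≠ j → ¬ l i ∣ l j) {b : ℕ} (hb : 0 < b) {a : ι → L}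
    (ha : ∀ j, a j ^ b = algebraMap R L (l j)) {F : MvPolynomial ι ℂ}
    (hF : MvPolynomial.aeval a F = 0) {S : Type} [CommRing S] [Algebra ℂ S] (φ : R →ₐ[ℂ] S)
    {c : ι → S} (hc : ∀ j, c j ^ b = φ (l j)) :
    MvPolynomial.aeval c F = 0 := by
  classical
  have hinj : Function.Injective (algebraMap R L) := by
    rw [IsScalarTower.algebraMap_eq R K L]
    exact (algebraMap K L).injective.comp (IsFractionRing.injective R K)
  have ha0 : ∀ j, a j ≠ 0 := by
    intro j hj
    have := ha j
    rw [hj, zero_pow hb.ne'] at this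
    exact (hl j).ne_zero (hinj (by rw [← this, map_zero]))
  have hp0 : ∀ m : ι → ℕ, ∏ j, a j ^ m j ≠ 0 := fun m =>
    Finset.prod_ne_zero_iff.2 fun j _ => pow_ne_zero _ (ha0 j)
  -- `K` contains `ℂ`, hence all `b`-th roots of unity; Galois therefore fixes them, which makes `χ`
  -- below multiplicative.
  have hmu : ∀ x : L, x ^ b = 1 → ∃ y : K, algebraMap K L y = x := by
    intro x hx
    have : NeZero b := ⟨hb.ne'⟩
    obtain ⟨i, -, hi⟩ := ((Complex.isPrimitiveRoot_exp b hb.ne').map_of_injective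
      (algebraMap ℂ L).injective).eq_pow_of_pow_eq_one hx
    refine ⟨algebraMap ℂ K (Complex.exp (2 * Real.pi * Complex.I / b) ^ i), ?_⟩
    rw [← IsScalarTower.algebraMap_apply, map_pow, hi]
  have hpow : ∀ (m : ι → ℕ) (g : Gal(L/K)), (g (∏ j, a j ^ m j) / ∏ j, a j ^ m j) ^ b = 1 := by
    intro m g
    have : (∏ j, a j ^ m j) ^ b = algebraMap K L (algebraMap R K (∏ j, l j ^ m j)) := by
      rw [← IsScalarTower.algebraMap_apply, map_prod, ← Finset.prod_pow]
      refine Finset.prod_congr rfl fun j _ => ?_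
      rw [map_pow, ← ha, ← pow_mul, ← pow_mul, mul_comm]
    rw [div_pow, ← map_pow, this, AlgEquiv.commutes, ← this, div_self (pow_ne_zero _ (hp0 m))]
  let χ : (ι →₀ ℕ) → (Gal(L/K) →* L) := fun m =>
    { toFun := fun g => g (∏ j, a j ^ m j) / ∏ j, a j ^ m j
      map_one' := by simp [div_self (hp0 m)]
      map_mul' := by
        intro g h
        obtain ⟨y, hy⟩ := hmu _ (hpow m h)
        have hh : h (∏ j, a j ^ m j) = algebraMap K L y * ∏ j, a j ^ m j := by
          rw [hy, div_mul_cancel₀ _ (hp0 m)]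
        rw [← hy, AlgEquiv.mul_apply, hh, map_mul, AlgEquiv.commutes]
        ring }
  have hχ : ∀ m g, χ m g = g (∏ j, a j ^ m j) / ∏ j, a j ^ m j := fun _ _ => rfl
  have hsum : ∀ {T : Type} [CommRing T] [Algebra ℂ T] (t : ι → T),
      MvPolynomial.aeval t F = ∑ ξ ∈ F.support.image χ, ∑ m ∈ F.support with χ m = ξ,
        algebraMap ℂ T (F.coeff m) * ∏ j, t j ^ m j := by
    intro T _ _ t
    rw [Finset.sum_fiberwise_of_maps_to (fun m hm => Finset.mem_image_of_mem χ hm),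
      MvPolynomial.aeval_eq_eval₂Hom, MvPolynomial.coe_eval₂Hom, MvPolynomial.eval₂_eq']
  -- Dedekind independence of characters: applying every `g` to the relation forces each isotypic
  -- part to vanish separately.
  have hpart : ∀ ξ ∈ F.support.image χ, ∑ m ∈ F.support with χ m = ξ,
      algebraMap ℂ L (F.coeff m) * ∏ j, a j ^ m j = 0 := by
    refine linearIndependent_iff'.1 (linearIndependent_monoidHom Gal(L/K) L) (F.support.image χ)
      (fun ξ => ∑ m ∈ F.support with χ m = ξ, algebraMap ℂ L (F.coeff m) * ∏ j, a j ^ m j) ?_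
    ext g
    have hg := congrArg g hF
    rw [map_zero, hsum, map_sum] at hg
    rw [Finset.sum_apply, Pi.zero_apply, ← hg]
    refine Finset.sum_congr rfl fun ξ _ => ?_
    rw [Pi.smul_apply, smul_eq_mul, Finset.sum_mul, map_sum]
    refine Finset.sum_congr rfl fun m hm => ?_
    rw [← (Finset.mem_filter.1 hm).2, hχ, map_mul, IsScalarTower.algebraMap_apply ℂ K L,
      AlgEquiv.commutes, mul_assoc, mul_div_cancel₀ _ (hp0 m)]
  have hfac : ∀ {T : Type} [CommRing T] (t : ι → T) (m : ι → ℕ),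
      ∏ j, t j ^ m j = (∏ j, t j ^ (m j % b)) * ∏ j, (t j ^ b) ^ (m j / b) := by
    intro T _ t m
    rw [← Finset.prod_mul_distrib]
    refine Finset.prod_congr rfl fun j _ => ?_
    rw [← pow_mul, ← pow_add, Nat.mod_add_div]
  rw [hsum]
  refine Finset.sum_eq_zero fun ξ hξ => ?_
  obtain ⟨m₀, -, rfl⟩ := Finset.mem_image.1 hξ
  have hmod : ∀ m, χ m = χ m₀ → ∀ j, m j % b = m₀ j % b := fun m hm j =>
    modEq_of_galois_smul_eq (K := K) hl hnd hb ha
      (fun g => by simpa only [hχ] using DFunLike.congr_fun hm g) j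
  -- Monomials with one character share their exponents mod `b`, so a common monomial splits off.
  -- The cofactor is the image of a single element of `R`, independent of `ψ` and `t`; its vanishing
  -- in `L` thus transfers to `S`.
  have hgen : ∀ {T : Type} [CommRing T] [Algebra ℂ T] (ψ : R →ₐ[ℂ] T) (t : ι → T),
      (∀ j, t j ^ b = ψ (l j)) →
      ∑ m ∈ F.support with χ m = χ m₀, algebraMap ℂ T (F.coeff m) * ∏ j, t j ^ m j =
        (∏ j, t j ^ (m₀ j % b)) * ψ (∑ m ∈ F.support with χ m = χ m₀,
          algebraMap ℂ R (F.coeff m) * ∏ j, l j ^ (m j / b)) := by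
    intro T _ _ ψ t ht
    rw [map_sum, Finset.mul_sum]
    refine Finset.sum_congr rfl fun m hm => ?_
    rw [hfac, map_mul, AlgHom.commutes, map_prod,
      Finset.prod_congr rfl fun j _ => by rw [hmod m (Finset.mem_filter.1 hm).2 j]]
    simp only [map_pow, ht]
    ring
  have hR : ∑ m ∈ F.support with χ m = χ m₀,
      algebraMap ℂ R (F.coeff m) * ∏ j, l j ^ (m j / b) = 0 := by
    have := hpart _ hξ
    rw [hgen (IsScalarTower.toAlgHom ℂ R L) a ha] at this
    apply hinj
    rw [map_zero]
    exact (mul_eq_zero.1 this).resolve_left (hp0 _)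
  rw [hgen φ c hc, hR, map_zero, mul_zero]

end Kummer

/-- The variety of radicals of pairwise non-associated irreducible polynomials is irreducible. -/
theorem isPrime_vanishing_radicals {σ ι : Type} [Finite σ] [Fintype ι]
    {l : ι → MvPolynomial σ ℂ} (hl : ∀ j, Prime (l j)) (hnd : ∀ i j, i ≠ j → ¬ l i ∣ l j) {b : ℕ}
    (hb : 0 < b) {F G : MvPolynomial ι ℂ}
    (hFG : ∀ (p : σ → ℂ) (c : ι → ℂ), (∀ j, c j ^ b = MvPolynomial.eval p (l j)) →
      MvPolynomial.eval c (F * G) = 0) :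
    (∀ (p : σ → ℂ) (c : ι → ℂ), (∀ j, c j ^ b = MvPolynomial.eval p (l j)) →
      MvPolynomial.eval c F = 0) ∨
    (∀ (p : σ → ℂ) (c : ι → ℂ), (∀ j, c j ^ b = MvPolynomial.eval p (l j)) →
      MvPolynomial.eval c G = 0) := by
  classical
  let K := FractionRing (MvPolynomial σ ℂ)
  let L := AlgebraicClosure K
  choose a ha using fun j => IsAlgClosed.exists_pow_nat_eq
    (algebraMap (MvPolynomial σ ℂ) L (l j)) hb
  have hback : ∀ H : MvPolynomial ι ℂ, MvPolynomial.aeval a H = 0 →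
      ∀ (p : σ → ℂ) (c : ι → ℂ), (∀ j, c j ^ b = MvPolynomial.eval p (l j)) →
      MvPolynomial.eval c H = 0 := by
    intro H hH p c hc
    exact eval₂_eq_zero_of_aeval_radical_eq_zero (K := K) hl hnd hb ha hH
      (MvPolynomial.aeval p) (c := c) (by simpa [MvPolynomial.aeval_eq_eval] using hc)
  have hzero : MvPolynomial.aeval a (F * G) = 0 := by
    let θ : MvPolynomial (σ ⊕ ι) ℂ →ₐ[ℂ] L := MvPolynomial.aeval
      (Sum.elim (fun s => algebraMap (MvPolynomial σ ℂ) L (MvPolynomial.X s)) a)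
    have hθl : ∀ H : MvPolynomial σ ℂ,
        θ (MvPolynomial.rename Sum.inl H) = algebraMap (MvPolynomial σ ℂ) L H := by
      intro H
      have : θ.comp (MvPolynomial.rename Sum.inl) =
          IsScalarTower.toAlgHom ℂ (MvPolynomial σ ℂ) L := by
        ext s
        simp [θ]
      exact DFunLike.congr_fun this H
    have hθr : ∀ H : MvPolynomial ι ℂ,
        θ (MvPolynomial.rename Sum.inr H) = MvPolynomial.aeval a H := by
      intro H
      simp only [θ, MvPolynomial.aeval_rename, Sum.elim_comp_inr]
    let P : Ideal (MvPolynomial (σ ⊕ ι) ℂ) := RingHom.ker θ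
    have : P.IsPrime := RingHom.ker_isPrime θ
    have hmem : MvPolynomial.rename Sum.inr (F * G) ∈ P := by
      -- Nullstellensatz for the prime `P` of relations at the generic point: every zero of `P` is a
      -- pair `(p, c)` with `c j ^ b = l j (p)`, so `hFG` applies to it.
      rw [← MvPolynomial.IsPrime.vanishingIdeal_zeroLocus (K := ℂ) P]
      intro x hx
      rw [MvPolynomial.aeval_rename]
      refine hFG (x ∘ Sum.inl) (x ∘ Sum.inr) fun j => ?_
      have hrel : MvPolynomial.X (Sum.inr j) ^ b - MvPolynomial.rename Sum.inl (l j) ∈ P := by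
        rw [RingHom.mem_ker, map_sub, hθl, map_pow, ← ha]
        simp [θ]
      have := hx _ hrel
      rw [map_sub, map_pow, MvPolynomial.aeval_X, MvPolynomial.aeval_rename, sub_eq_zero] at this
      exact this
    rw [← hθr]
    exact hmem
  rw [map_mul, mul_eq_zero] at hzero
  exact hzero.imp (hback F) (hback G)


/-! ### Coordinates on the lifted varieties. -/

/-- The linear form `u y - v x` on `ℂ²` vanishing at `[x : y]`. -/
def linForm (x w : Fin 2 → ℂ) : ℂ := w 0 * x 1 - w 1 * x 0

/-- Expanding the product over subsets `A` and grouping by `|A| = j` gives the row of `van q` paired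
with the `σ_j`. -/
theorem van_mulVec_sigma {n : ℕ} (q : Fin (n + 1) → Fin 2 → ℂ) (w : Fin n → Fin 2 → ℂ)
    (i : Fin (n + 1)) :
    (van q).mulVec (fun j : Fin (n + 1) => sigma (j : ℕ) w) i = ∏ α, linForm (q i) (w α) := by
  have h : ∀ α, linForm (q i) (w α) = w α 0 * q i 1 + -(w α 1 * q i 0) := fun α => sub_eq_add_neg _ _
  simp only [h]
  rw [Finset.prod_add, Finset.sum_powerset, Finset.card_univ, Fintype.card_fin,
    Finset.sum_range, Matrix.mulVec, dotProduct]
  refine Finset.sum_congr rfl fun j _ => ?_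
  rw [sigma, Finset.mul_sum]
  refine Finset.sum_congr rfl fun A hA => ?_
  have hA' := (Finset.mem_powersetCard.1 hA).2
  rw [← Finset.compl_eq_univ_sdiff, Finset.prod_neg, Finset.prod_mul_distrib,
    Finset.prod_mul_distrib, Finset.prod_const, Finset.prod_const, Finset.card_compl,
    Fintype.card_fin, hA', van, Matrix.of_apply]
  ring

theorem linForm_self (x : Fin 2 → ℂ) : linForm x x = 0 := by
  rw [linForm]
  ring

section

variable {n : ℕ} {q : Fin (n + 1) → Fin 2 → ℂ} (hq : ∀ i, q i ≠ 0)
  (hinj : Function.Injective fun i => Projectivization.mk ℂ (q i) (hq i))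

include hinj in
theorem linForm_ne_zero {i j : Fin (n + 1)} (hij : i ≠ j) : linForm (q i) (q j) ≠ 0 := by
  intro h
  rw [linForm, sub_eq_zero] at h
  refine hij (hinj ?_)
  simp only [Projectivization.mk_eq_mk_iff']
  by_cases hj0 : q j 0 = 0
  · have hj1 : q j 1 ≠ 0 := fun h1 => hq j (by ext a; fin_cases a <;> assumption)
    have hi0 : q i 0 = 0 := by
      rw [hj0, zero_mul] at h
      exact (mul_eq_zero.mp h.symm).resolve_left hj1
    refine ⟨q i 1 / q j 1, ?_⟩
    ext a
    fin_cases a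
    · simp [hj0, hi0]
    · simp [hj1]
  · refine ⟨q i 0 / q j 0, ?_⟩
    ext a
    fin_cases a
    · simp [hj0]
    · simp only [Fin.mk_one, Pi.smul_apply, smul_eq_mul]
      field_simp
      linear_combination -h

/-- The retraction of `{0, …, n - 1}` onto `{0, …, k - 1}` that collapses the upper part. -/
def collapse {k : ℕ} (n : ℕ) (hk : 1 ≤ k) (i : Fin n) : Fin k :=
  ⟨min i (k - 1), by omega⟩

/-- The projective scalar has a `b`-th root in `ℂ`, which is `μ`; `collapse` encodes the repetition
of the last of the `k` points. -/
theorem mk_mem_Dlift_iff {k b : ℕ} (hk : 1 ≤ k) (hkn : k ≤ n) (hb : 1 ≤ b)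
    {z : Fin (n + 1) → ℂ} (hz : z ≠ 0) :
    Projectivization.mk ℂ z hz ∈ Dlift q hq hinj k b ↔
      ∃ w : Fin k → Fin 2 → ℂ, (∀ α, w α ≠ 0) ∧ ∃ μ : ℂ, μ ≠ 0 ∧
        ∀ i, (μ * z i) ^ b = ∏ j, linForm (q i) (w (collapse n hk j)) := by
  have hpsi : ∀ h, psi b (Projectivization.mk ℂ z hz) =
      Projectivization.mk ℂ (fun i => z i ^ b) h := fun _ => rfl
  have hzb : (fun i => z i ^ b) ≠ 0 := fun h =>
    hz (funext fun i => eq_zero_of_pow_eq_zero (congrFun h i))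
  rw [Dlift, Set.mem_preimage, hpsi hzb]
  constructor
  · rintro ⟨_, ⟨p, hp, rfl⟩, h⟩
    rw [phi, Projectivization.map_mk, Projectivization.mk_eq_mk_iff] at h
    obtain ⟨c, hc⟩ := h
    obtain ⟨μ, hμ⟩ := IsAlgClosed.exists_pow_nat_eq (c : ℂ) hb
    refine ⟨fun α => (p ⟨α, α.2.trans_le hkn⟩).rep, fun α => Projectivization.rep_nonzero _, μ,
      ?_, fun i => ?_⟩
    · rintro rfl
      rw [zero_pow (by omega)] at hμ
      exact c.ne_zero hμ.symm
    · have hi := congrFun hc i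
      rw [Matrix.mulVecLin_apply, van_mulVec_sigma, Units.smul_def, Pi.smul_apply,
        smul_eq_mul, ← hμ, ← mul_pow] at hi
      rw [hi]
      refine Finset.prod_congr rfl fun j _ => ?_
      by_cases hj : (j : ℕ) ≤ k - 1
      · congr 3
        exact Fin.ext (min_eq_left hj).symm
      · congr 2
        refine hp _ _ (by omega) ?_
        simp only [collapse]
        omega
  · rintro ⟨w, hw, μ, hμ, h⟩
    refine ⟨_, ⟨fun j => Projectivization.mk ℂ (w (collapse n hk j)) (hw _), ?_, rfl⟩, ?_⟩
    · intro i j hi hj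
      have : collapse n hk i = collapse n hk j := by
        simp only [collapse, Fin.mk.injEq]
        omega
      simp only [this]
    · rw [phi_mk (fun j => w (collapse n hk j)), Projectivization.map_mk,
        Projectivization.mk_eq_mk_iff']
      refine ⟨μ ^ b, ?_⟩
      ext i
      rw [Matrix.mulVecLin_apply, van_mulVec_sigma, Pi.smul_apply, smul_eq_mul, ← mul_pow, h]

end

/-! ### Irreducibility from a block of size prime to `b`. -/

theorem isClosed_zariski_iff {n : ℕ} {Z : Set (PP n)} :
    @IsClosed _ (zariski n) Z ↔ ∃ S : Set (MvPolynomial (Fin (n + 1)) ℂ),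
      (∀ F ∈ S, ∃ d, F.IsHomogeneous d) ∧ Z = zeroLocus S := by
  rw [← @isOpen_compl_iff _ _ (zariski n)]
  change Zᶜᶜ ∈ _ ↔ _
  rw [compl_compl]
  rfl

theorem exists_root_of_unity_pow_eq {e b : ℕ} (h : Nat.Coprime e b) {ζ : ℂ} (hb : b ≠ 0)
    (hζ : ζ ^ b = 1) : ∃ ω : ℂ, ω ^ b = 1 ∧ ω ^ e = ζ := by
  have h0 : ζ ≠ 0 := by
    rintro rfl
    rw [zero_pow hb] at hζ
    exact zero_ne_one hζ
  have hbez := Nat.gcd_eq_gcd_ab e b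
  rw [h.gcd_eq_one] at hbez
  refine ⟨ζ ^ (Nat.gcdA e b), ?_, ?_⟩
  · rw [← zpow_natCast, ← zpow_mul, mul_comm, zpow_mul, zpow_natCast, hζ, one_zpow]
  · rw [← zpow_natCast, ← zpow_mul,
      show Nat.gcdA e b * (e : ℤ) = 1 - b * Nat.gcdB e b by push_cast at hbez; linarith,
      zpow_sub₀ h0, zpow_mul, zpow_natCast, hζ, one_zpow, zpow_one, div_one]

theorem exists_mul_eq_of_pow_eq {b : ℕ} (hb : b ≠ 0) {x y : ℂ} (h : x ^ b = y ^ b) :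
    ∃ ζ : ℂ, ζ ^ b = 1 ∧ x = ζ * y := by
  by_cases hy : y = 0
  · refine ⟨1, one_pow _, ?_⟩
    rw [hy, zero_pow hb] at h
    rw [hy, mul_zero]
    exact eq_zero_of_pow_eq_zero h
  · exact ⟨x / y, by rw [div_pow, h, div_self (pow_ne_zero _ hy)], (div_mul_cancel₀ _ hy).symm⟩

/-- The linear form `linForm x` in the `α`-th pair of variables. -/
noncomputable def linPoly {k : ℕ} (x : Fin 2 → ℂ) (α : Fin k) :
    MvPolynomial (Fin k × Fin 2) ℂ :=
  MvPolynomial.sumSMulX (Finsupp.single (α, 0) (x 1) + Finsupp.single (α, 1) (-x 0))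

theorem eval_linPoly {k : ℕ} (x : Fin 2 → ℂ) (α : Fin k) (p : Fin k × Fin 2 → ℂ) :
    MvPolynomial.eval p (linPoly x α) = linForm x (fun t => p (α, t)) := by
  simp only [linPoly, map_add, MvPolynomial.sumSMulX, Finsupp.linearCombination_single,
    MvPolynomial.smul_eval, MvPolynomial.eval_X, linForm]
  ring

theorem prime_linPoly {k : ℕ} {x : Fin 2 → ℂ} (hx : x ≠ 0) (α : Fin k) :
    Prime (linPoly x α) := by
  set c : Fin k × Fin 2 →₀ ℂ :=
    Finsupp.single (α, 0) (x 1) + Finsupp.single (α, 1) (-x 0) with hc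
  have h0 : c (α, 0) = x 1 := by simp [hc]
  have h1 : c (α, 1) = -x 0 := by simp [hc]
  have hex : ∃ s, c s ≠ 0 := by
    by_contra! hcon
    refine hx (funext fun t => ?_)
    fin_cases t
    · exact neg_eq_zero.1 (h1.symm.trans (hcon _))
    · exact h0.symm.trans (hcon _)
  obtain ⟨s, hs⟩ := hex
  refine (MvPolynomial.irreducible_sumSMulX (c := c) ⟨s, Finsupp.mem_support_iff.2 hs⟩
    fun r hr => ?_).prime
  exact isUnit_iff_ne_zero.2 (ne_zero_of_dvd_ne_zero hs (hr s))

section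

variable {n : ℕ} {q : Fin (n + 1) → Fin 2 → ℂ} (hq : ∀ i, q i ≠ 0)
  (hinj : Function.Injective fun i => Projectivization.mk ℂ (q i) (hq i))

include hinj in
theorem not_linPoly_dvd_linPoly (hn : 1 ≤ n) {k : ℕ} {s t : Fin k × Fin (n + 1)} (hst : s ≠ t) :
    ¬ linPoly (q s.2) s.1 ∣ linPoly (q t.2) t.1 := by
  rintro ⟨H, hH⟩
  have : Nontrivial (Fin (n + 1)) := Fin.nontrivial_iff_two_le.2 (by omega)
  obtain ⟨j, hj⟩ := exists_ne t.2
  -- A point where the divisor vanishes: `q s.2` in block `s.1`, and in the other blocks some `q j`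
  -- with `j ≠ t.2`, so that the dividend does not vanish.
  have h := congrArg (MvPolynomial.eval fun u : Fin k × Fin 2 =>
    if u.1 = s.1 then q s.2 u.2 else q j u.2) hH
  rw [map_mul, eval_linPoly, eval_linPoly] at h
  simp only [if_true] at h
  rw [linForm_self, zero_mul] at h
  by_cases h1 : t.1 = s.1
  · simp only [h1, if_true] at h
    exact linForm_ne_zero hq hinj (fun h2 => hst (Prod.ext h1.symm h2.symm)) h
  · simp only [h1, if_false] at h
    exact linForm_ne_zero hq hinj hj.symm h

/-- Arbitrary radicals give each coordinate up to a `b`-th root of unity `ζ i`. Scaling the radicals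
of block `α₀` by `ω i` multiplies coordinate `i` by `ω i` to the block size, and coprimality lets
this equal `ζ i`. -/
theorem exists_radicals_of_mem_Dlift {k b : ℕ} (hk : 1 ≤ k) (hkn : k ≤ n) (hb : 1 ≤ b)
    (α₀ : Fin k) (hcop : Nat.Coprime (Finset.univ.filter fun j => collapse n hk j = α₀).card b)
    {v : PP n} (hv : v ∈ Dlift q hq hinj k b) :
    ∃ (p : Fin k × Fin 2 → ℂ) (c : Fin k × Fin (n + 1) → ℂ),
      (∀ s, c s ^ b = MvPolynomial.eval p (linPoly (q s.2) s.1)) ∧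
      ∃ h, v = Projectivization.mk ℂ (fun i => ∏ j, c (collapse n hk j, i)) h := by
  classical
  induction v using Projectivization.ind with | h z hz => ?_
  obtain ⟨w, -, μ, hμ, h⟩ := (mk_mem_Dlift_iff hq hinj hk hkn hb hz).1 hv
  choose a ha using fun s : Fin k × Fin (n + 1) =>
    IsAlgClosed.exists_pow_nat_eq (linForm (q s.2) (w s.1)) hb
  have hza : ∀ i, ∃ ζ : ℂ, ζ ^ b = 1 ∧ μ * z i = ζ * ∏ j, a (collapse n hk j, i) := fun i =>
    exists_mul_eq_of_pow_eq (by omega) (by rw [h, ← Finset.prod_pow]; simp only [ha])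
  choose ζ hζ hzζ using hza
  choose ω hω hωζ using fun i => exists_root_of_unity_pow_eq hcop (by omega) (hζ i)
  have hc : ∀ i, ∏ j, (if collapse n hk j = α₀ then ω i else 1) * a (collapse n hk j, i) =
      μ * z i := by
    intro i
    rw [hzζ, ← hωζ, Finset.prod_mul_distrib, Finset.prod_ite, Finset.prod_const_one, mul_one,
      Finset.prod_const]
  refine ⟨fun u => w u.1 u.2, fun s => (if s.1 = α₀ then ω s.2 else 1) * a s, fun s => ?_, ?_⟩
  · rw [eval_linPoly, mul_pow, ha]
    split_ifs
    · rw [hω, one_mul]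
    · rw [one_pow, one_mul]
  · simp only [hc]
    refine ⟨fun h0 => hz (funext fun i => ?_), ?_⟩
    · exact (mul_eq_zero.1 (congrFun h0 i)).resolve_left hμ
    · rw [Projectivization.mk_eq_mk_iff']
      refine ⟨μ⁻¹, ?_⟩
      ext i
      rw [Pi.smul_apply, smul_eq_mul, inv_mul_cancel_left₀ hμ]

theorem mk_prod_radicals_mem_Dlift {k b : ℕ} (hk : 1 ≤ k) (hkn : k ≤ n) (hb : 1 ≤ b)
    {p : Fin k × Fin 2 → ℂ} {c : Fin k × Fin (n + 1) → ℂ}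
    (hc : ∀ s, c s ^ b = MvPolynomial.eval p (linPoly (q s.2) s.1))
    (h : (fun i => ∏ j, c (collapse n hk j, i)) ≠ 0) :
    Projectivization.mk ℂ (fun i => ∏ j, c (collapse n hk j, i)) h ∈ Dlift q hq hinj k b := by
  refine (mk_mem_Dlift_iff hq hinj hk hkn hb h).2
    ⟨fun α t => p (α, t), fun α hα => h (funext fun i => ?_), 1, one_ne_zero, fun i => ?_⟩
  · have hlt : (α : ℕ) < n := α.2.trans_le hkn
    refine Finset.prod_eq_zero (Finset.mem_univ (⟨α, hlt⟩ : Fin n)) ?_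
    have hcol : collapse n hk ⟨α, hlt⟩ = α := by
      ext
      simp only [collapse]
      omega
    have h0 : c (α, i) ^ b = 0 := by
      rw [hc, eval_linPoly]
      have hα' : ∀ t, p (α, t) = 0 := congrFun hα
      simp only [linForm, hα', zero_mul, sub_zero]
    rw [hcol]
    exact eq_zero_of_pow_eq_zero h0
  · rw [one_mul, ← Finset.prod_pow]
    exact Finset.prod_congr rfl fun j _ => by rw [hc, eval_linPoly]

theorem irreducibleSubvariety_Dlift (hn : 1 ≤ n) {k b : ℕ} (hk : 1 ≤ k) (hkn : k ≤ n)
    (hb : 1 ≤ b) (α₀ : Fin k)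
    (hcop : Nat.Coprime (Finset.univ.filter fun j => collapse n hk j = α₀).card b) :
    IrreducibleSubvariety (Dlift q hq hinj k b) := by
  have : Nontrivial (Fin (n + 1)) := Fin.nontrivial_iff_two_le.2 (by omega)
  obtain ⟨i₁, hi₁⟩ := exists_ne (0 : Fin (n + 1))
  let Z : Fin (n + 1) → MvPolynomial (Fin k × Fin (n + 1)) ℂ := fun i =>
    ∏ j, MvPolynomial.X (collapse n hk j, i)
  have hZ : ∀ c i, MvPolynomial.eval c (Z i) = ∏ j, c (collapse n hk j, i) := fun c i => by
    simp only [Z, map_prod, MvPolynomial.eval_X]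
  have hbind : ∀ (c) (F : MvPolynomial (Fin (n + 1)) ℂ),
      MvPolynomial.eval c (MvPolynomial.bind₁ Z F) =
        MvPolynomial.eval (fun i => ∏ j, c (collapse n hk j, i)) F := by
    intro c F
    rw [MvPolynomial.eval, MvPolynomial.eval₂Hom_bind₁]
    simp only [← hZ]
    rfl
  have hprime := fun F G => isPrime_vanishing_radicals
    (l := fun s : Fin k × Fin (n + 1) => linPoly (q s.2) s.1) (fun s => prime_linPoly (hq _) _)
    (fun s t hst => not_linPoly_dvd_linPoly hq hinj hn hst) (b := b) hb (F := F) (G := G)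
  -- A radical point with nonzero coordinate 0: put every block at `q i₁`, where the form of `q 0`
  -- does not vanish.
  obtain ⟨a, ha⟩ : ∃ a : Fin k × Fin (n + 1) → ℂ, ∀ s, a s ^ b = MvPolynomial.eval
      (fun u : Fin k × Fin 2 => q i₁ u.2) (linPoly (q s.2) s.1) :=
    ⟨_, fun s => (IsAlgClosed.exists_pow_nat_eq _ hb).choose_spec⟩
  have ha0 : ∏ j, a (collapse n hk j, 0) ≠ 0 := by
    refine Finset.prod_ne_zero_iff.2 fun j _ h0 => ?_
    have := ha (collapse n hk j, 0)
    rw [h0, zero_pow (by omega), eval_linPoly] at this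
    exact linForm_ne_zero hq hinj hi₁.symm this.symm
  let := zariski n
  change IsIrreducible _
  refine ⟨⟨_, mk_prod_radicals_mem_Dlift hq hinj hk hkn hb ha fun h => ha0 (congrFun h 0)⟩,
    isPreirreducible_iff_isClosed_union_isClosed.2 fun V W hV hW hVW => ?_⟩
  obtain ⟨S, hS, rfl⟩ := isClosed_zariski_iff.1 hV
  obtain ⟨T, hT, rfl⟩ := isClosed_zariski_iff.1 hW
  by_contra! hcon
  obtain ⟨⟨v, hv, hvS⟩, w, hw, hwT⟩ :=
    And.intro (Set.not_subset.1 hcon.1) (Set.not_subset.1 hcon.2)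
  simp only [zeroLocus, Set.mem_ofPred_eq, not_forall] at hvS hwT
  obtain ⟨F, hF, hF0⟩ := hvS
  obtain ⟨G, hG, hG0⟩ := hwT
  obtain ⟨d, hd⟩ := hS F hF
  obtain ⟨e, he⟩ := hT G hG
  -- The factor `Z 0` kills the radical points whose product vector might be zero and so define no
  -- point of projective space. Primality removes it again, since it is nonzero at `a`.
  have hmul : ∀ (p : Fin k × Fin 2 → ℂ) (c : Fin k × Fin (n + 1) → ℂ),
      (∀ s, c s ^ b = MvPolynomial.eval p (linPoly (q s.2) s.1)) →
      MvPolynomial.eval c (Z 0 * (MvPolynomial.bind₁ Z F * MvPolynomial.bind₁ Z G)) = 0 := by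
    intro p c hc
    rw [map_mul, map_mul, hbind, hbind, hZ]
    by_cases h0 : ∏ j, c (collapse n hk j, 0) = 0
    · rw [h0, zero_mul]
    · have hne : (fun i => ∏ j, c (collapse n hk j, i)) ≠ 0 := fun h => h0 (congrFun h 0)
      rcases hVW (mk_prod_radicals_mem_Dlift hq hinj hk hkn hb hc hne) with h | h
      · rw [(eval_rep_eq_zero hd _ hne).1 (h F hF), zero_mul, mul_zero]
      · rw [(eval_rep_eq_zero he _ hne).1 (h G hG), mul_zero, mul_zero]
  rcases hprime _ _ hmul with h | h
  · exact ha0 (by rw [← hZ]; exact h _ a ha)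
  · rcases hprime _ _ (fun p c hc => h p c hc) with h | h
    · obtain ⟨p, c, hc, hne, rfl⟩ := exists_radicals_of_mem_Dlift hq hinj hk hkn hb α₀ hcop hv
      exact hF0 ((eval_rep_eq_zero hd _ hne).2 (by rw [← hbind]; exact h p c hc))
    · obtain ⟨p, c, hc, hne, rfl⟩ := exists_radicals_of_mem_Dlift hq hinj hk hkn hb α₀ hcop hw
      exact hG0 ((eval_rep_eq_zero he _ hne).2 (by rw [← hbind]; exact h p c hc))

end


/-! ### Reducibility of the curve when `gcd(n, b) > 1`. -/

/-- More than `m + 1` powers `(linForm (q i)) ^ m` are linearly dependent. -/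
theorem exists_linear_relation_linForm_pow {n m : ℕ} (hmn : m < n)
    (q : Fin (n + 1) → Fin 2 → ℂ) :
    ∃ c : Fin (n + 1) → ℂ, c ≠ 0 ∧ ∀ w, ∑ i, c i * linForm (q i) w ^ m = 0 := by
  let v : Fin (n + 1) → Fin (m + 1) → ℂ := fun i j => q i 1 ^ (j : ℕ) * (-q i 0) ^ (m - (j : ℕ))
  have hdep : ¬ LinearIndependent ℂ v := by
    intro h
    have := h.fintype_card_le_finrank
    simp only [Fintype.card_fin, Module.finrank_fin_fun] at this
    omega
  obtain ⟨c, hc, i, hi⟩ := Fintype.not_linearIndependent_iff.1 hdep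
  refine ⟨c, fun h => hi (congrFun h i), fun w => ?_⟩
  have hpow : ∀ i, linForm (q i) w ^ m =
      ∑ j : Fin (m + 1), w 0 ^ (j : ℕ) * w 1 ^ (m - (j : ℕ)) * m.choose j * v i j := by
    intro i
    rw [show linForm (q i) w = w 0 * q i 1 + w 1 * -q i 0 by rw [linForm]; ring, add_pow,
      Finset.sum_range]
    refine Finset.sum_congr rfl fun j _ => ?_
    simp only [v, mul_pow]
    ring
  simp only [hpow, Finset.mul_sum]
  rw [Finset.sum_comm]
  refine Finset.sum_eq_zero fun j _ => ?_
  have hj := congrFun hc j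
  simp only [Finset.sum_apply, Pi.smul_apply, smul_eq_mul, Pi.zero_apply] at hj
  rw [← mul_zero (w 0 ^ (j : ℕ) * w 1 ^ (m - (j : ℕ)) * m.choose j), ← hj, Finset.mul_sum]
  exact Finset.sum_congr rfl fun i _ => by ring

theorem gcd_eq_one_of_irreducibleSubvariety_Dlift {n b : ℕ} (hn : 1 ≤ n) (hb : 1 ≤ b)
    {q : Fin (n + 1) → Fin 2 → ℂ} (hq : ∀ i, q i ≠ 0)
    (hinj : Function.Injective fun i => Projectivization.mk ℂ (q i) (hq i))
    (hirr : IrreducibleSubvariety (Dlift q hq hinj 1 b)) : Nat.gcd n b = 1 := by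
  classical
  by_contra hgcd
  obtain ⟨n', hn'⟩ := Nat.gcd_dvd_left n b
  obtain ⟨b', hb'⟩ := Nat.gcd_dvd_right n b
  set d := Nat.gcd n b
  have hd0 : 0 < d := Nat.gcd_pos_of_pos_left _ hn
  have hd : 2 ≤ d := by omega
  have hb0 : 0 < b' := Nat.pos_of_ne_zero (by rintro rfl; omega)
  have hn0 : 0 < n' := Nat.pos_of_ne_zero (by rintro rfl; omega)
  obtain ⟨c, hc0, hc⟩ := exists_linear_relation_linForm_pow (m := n') (n := n) (by nlinarith) q
  obtain ⟨i₀, hi₀⟩ := Function.ne_iff.1 hc0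
  -- The relation among the `n'`-th powers, with each power replaced by `ζ i * z i ^ b'`; `ζ` ranges
  -- over the finite set `U` of tuples of `d`-th roots of unity.
  let F : (Fin (n + 1) → ℂ) → MvPolynomial (Fin (n + 1)) ℂ := fun ζ =>
    ∑ i, MvPolynomial.C (c i * ζ i) * MvPolynomial.X i ^ b'
  have hF : ∀ ζ, (F ζ).IsHomogeneous b' := fun ζ =>
    MvPolynomial.IsHomogeneous.sum _ _ _ fun i _ =>
      (MvPolynomial.isHomogeneous_X_pow i b').C_mul _
  have hFeval : ∀ ζ z, MvPolynomial.eval z (F ζ) = ∑ i, c i * ζ i * z i ^ b' := by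
    intro ζ z
    simp only [F, map_sum, map_mul, MvPolynomial.eval_C, map_pow, MvPolynomial.eval_X]
  let U := Fintype.piFinset fun _ : Fin (n + 1) => Polynomial.nthRootsFinset d (1 : ℂ)
  have hmem : ∀ {z : Fin (n + 1) → ℂ} (hz : z ≠ 0),
      Projectivization.mk ℂ z hz ∈ Dlift q hq hinj 1 b ↔ ∃ w : Fin 2 → ℂ, w ≠ 0 ∧ ∃ μ : ℂ, μ ≠ 0 ∧
        ∀ i, (μ * z i) ^ b = linForm (q i) w ^ n := by
    intro z hz
    rw [mk_mem_Dlift_iff hq hinj le_rfl hn hb hz]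
    constructor
    · rintro ⟨w, hw, μ, hμ, h⟩
      refine ⟨w 0, hw 0, μ, hμ, fun i => ?_⟩
      rw [h, Finset.prod_congr rfl fun j _ => by rw [Subsingleton.elim (collapse n le_rfl j) 0],
        Finset.prod_const, Finset.card_univ, Fintype.card_fin]
    · rintro ⟨w, hw, μ, hμ, h⟩
      refine ⟨fun _ => w, fun _ => hw, μ, hμ, fun i => ?_⟩
      rw [h, Finset.prod_const, Finset.card_univ, Fintype.card_fin]
  have hcover : Dlift q hq hinj 1 b ⊆ ⋃₀ ↑(U.image fun ζ => zeroLocus {F ζ}) := by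
    intro v hv
    have hv' := hv
    rw [← v.mk_rep, hmem] at hv'
    obtain ⟨w, -, μ, hμ, h⟩ := hv'
    have hζ : ∀ i, ∃ ζ : ℂ, ζ ^ d = 1 ∧ linForm (q i) w ^ n' = ζ * (μ * v.rep i) ^ b' := fun i =>
      exists_mul_eq_of_pow_eq hd0.ne' (by
        rw [← pow_mul, ← pow_mul, mul_comm n', mul_comm b', ← hn', ← hb', h])
    choose ζ hζ1 hζ2 using hζ
    refine ⟨zeroLocus {F ζ}, ?_, ?_⟩
    · refine Finset.mem_coe.2 (Finset.mem_image_of_mem _ (Fintype.mem_piFinset.2 fun i => ?_))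
      exact (Polynomial.mem_nthRootsFinset hd0 1).2 (hζ1 i)
    · rintro _ rfl
      have hw := hc w
      rw [hFeval]
      refine (mul_eq_zero.1 (?_ : μ ^ b' * _ = 0)).resolve_left (pow_ne_zero _ hμ)
      rw [← hw, Finset.mul_sum]
      refine Finset.sum_congr rfl fun i _ => ?_
      rw [hζ2, mul_pow]
      ring
  obtain ⟨_, hZ, hsub⟩ := (@isIrreducible_iff_sUnion_isClosed _ (zariski n) _).1 hirr _ (by
    intro V hV
    obtain ⟨ζ, -, rfl⟩ := Finset.mem_image.1 hV
    refine isClosed_zariski_iff.2 ⟨_, ?_, rfl⟩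
    rintro _ rfl
    exact ⟨b', hF ζ⟩) hcover
  obtain ⟨ζ, hζ, rfl⟩ := Finset.mem_image.1 hZ
  have : Nontrivial (Fin (n + 1)) := Fin.nontrivial_iff_two_le.2 (by omega)
  obtain ⟨i₁, hi₁⟩ := exists_ne i₀
  -- A point of the curve above `q i₁`, chosen so that the coordinate `i₀`, whose coefficient `c i₀`
  -- is nonzero, does not vanish.
  choose z hz using fun i => IsAlgClosed.exists_pow_nat_eq (linForm (q i) (q i₁) ^ n) hb
  have hz0 : z i₀ ≠ 0 := by
    intro h0
    have := hz i₀
    rw [h0, zero_pow (by omega)] at this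
    exact pow_ne_zero n (linForm_ne_zero hq hinj hi₁.symm) this.symm
  have hvan : ∀ ω : ℂ, ω ^ b = 1 →
      ∑ i, c i * ζ i * (Function.update z i₀ (ω * z i₀) i) ^ b' = 0 := by
    intro ω hω
    have hω0 : ω ≠ 0 := by
      rintro rfl
      rw [zero_pow (by omega)] at hω
      exact zero_ne_one hω
    have hne : Function.update z i₀ (ω * z i₀) ≠ 0 := fun h => mul_ne_zero hω0 hz0 (by
      simpa using congrFun h i₀)
    have hin := hsub ((hmem hne).2 ⟨q i₁, hq i₁, 1, one_ne_zero, fun i => by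
      rw [one_mul, ← hz]
      by_cases hi : i = i₀
      · subst hi
        rw [Function.update_self, mul_pow, hω, one_mul]
      · rw [Function.update_of_ne hi]⟩)
    rw [← hFeval]
    exact (eval_rep_eq_zero (hF ζ) _ hne).1 (hin _ rfl)
  have hprim := Complex.isPrimitiveRoot_exp b (by omega)
  set ω := Complex.exp (2 * Real.pi * Complex.I / b)
  have h1 := hvan 1 (one_pow _)
  have h2 := hvan ω hprim.pow_eq_one
  rw [one_mul, Function.update_eq_self] at h1
  -- Subtracting the relations before and after the rotation leaves only the term `i₀`, with factor
  -- `ω ^ b' - 1`; this is nonzero as `0 < b' < b`.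
  rw [← h1, ← sub_eq_zero, ← Finset.sum_sub_distrib, Finset.sum_eq_single i₀] at h2
  · rw [Function.update_self, mul_pow] at h2
    have hω : ω ^ b' ≠ 1 := hprim.pow_ne_one_of_pos_of_lt hb0.ne' (by nlinarith)
    have hζ0 : ζ i₀ ≠ 0 := by
      have := (Polynomial.mem_nthRootsFinset hd0 1).1 (Fintype.mem_piFinset.1 hζ i₀)
      intro h0
      rw [h0, zero_pow hd0.ne'] at this
      exact zero_ne_one this
    have h3 : (c i₀ * ζ i₀ * z i₀ ^ b') * (ω ^ b' - 1) = 0 := by linear_combination h2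
    exact mul_ne_zero (mul_ne_zero (mul_ne_zero hi₀ hζ0) (pow_ne_zero _ hz0))
      (sub_ne_zero.2 hω) h3
  · intro i _ hi
    rw [Function.update_of_ne hi, sub_self]
  · exact fun h => absurd (Finset.mem_univ _) h

/-- The block of index 0 serves: it has size `n` when `k = 1`, and size 1 when `k ≥ 2`. -/
theorem irreducibleSubvariety_Dlift_of_gcd_eq_one {n b : ℕ} (hn : 1 ≤ n) (hb : 1 ≤ b)
    {q : Fin (n + 1) → Fin 2 → ℂ} (hq : ∀ i, q i ≠ 0)
    (hinj : Function.Injective fun i => Projectivization.mk ℂ (q i) (hq i))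
    (hgcd : Nat.gcd n b = 1) {k : ℕ} (hk : 1 ≤ k) (hkn : k ≤ n) :
    IrreducibleSubvariety (Dlift q hq hinj k b) := by
  refine irreducibleSubvariety_Dlift hq hinj hn hk hkn hb ⟨0, hk⟩ ?_
  obtain rfl | hk2 := eq_or_lt_of_le hk
  · rw [Finset.filter_true_of_mem fun j _ => Subsingleton.elim _ _, Finset.card_univ,
      Fintype.card_fin]
    exact hgcd
  · have : (Finset.univ.filter fun j => collapse n hk j = ⟨0, hk⟩) = {⟨0, hn⟩} := by
      ext j
      simp only [Finset.mem_filter, Finset.mem_univ, true_and, Finset.mem_singleton, collapse,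
        Fin.ext_iff]
      omega
    rw [this, Finset.card_singleton]
    exact Nat.coprime_one_left b

end LiftedDiscriminant

theorem mainTheorem3 (n b : ℕ) (hn : 1 ≤ n) (hb : 1 ≤ b)
    (q : Fin (n + 1) → Fin 2 → ℂ) (hq : ∀ i, q i ≠ 0)
    (hinj : Function.Injective fun i => Projectivization.mk ℂ (q i) (hq i)) :
    (LiftedDiscriminant.IrreducibleSubvariety (LiftedDiscriminant.Dlift q hq hinj 1 b) ↔
        Nat.gcd n b = 1) ∧
      (Nat.gcd n b = 1 → ∀ k : ℕ, 1 ≤ k → k ≤ n →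
        LiftedDiscriminant.IrreducibleSubvariety (LiftedDiscriminant.Dlift q hq hinj k b)) :=
  ⟨⟨LiftedDiscriminant.gcd_eq_one_of_irreducibleSubvariety_Dlift hn hb hq hinj, fun h =>
      LiftedDiscriminant.irreducibleSubvariety_Dlift_of_gcd_eq_one hn hb hq hinj h le_rfl hn⟩,
    fun h _ hk hkn =>
      LiftedDiscriminant.irreducibleSubvariety_Dlift_of_gcd_eq_one hn hb hq hinj h hk hkn⟩
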